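/- Let $(M,g)$ be a smooth pseudo-Riemannian spin manifold of dimension $n$ and arbitrary signature, with Levi-Civita connection $\nabla$. Let $S\to M$ be the (real or complex) spinor bundle, i.e. the vector bundle associated with the spin structure by a finite-dimensional module of the Clifford algebra with $vw+wv=-2g(v,w)$, let $\gamma(X)\xi$ denote Clifford multiplication, and let $C$ be a charge conjugation on $S$: a nondegenerate spin-invariant bilinear form such that, for signs $\Delta_0,\Delta_1\in\{\pm1\}$, $C(\eta,\xi)=\Delta_0\,C(\xi,\eta)$ and $C(\eta,\gamma(X)\xi)=\Delta_1\,C(\xi,\gamma(X)\eta)$. (In indefinite signature the spin group is the group of even products $s$ of invertible vectors whose product with their reversal is $1$; this is the group that preserves such forms.) For spinor fields $\eta,\xi$ let $\{\eta,\xi\}$ be the vector field (complex if $S$ is complex) given by $g(\{\eta,\xi\},X)=2C_1(\eta\otimes\xi)(X)=2\,C(\eta,\gamma(X)\xi)$. Let $D$ be a connection on $S$, and let $D^C$ be the connection on $S$ determined by $$X\,C(\eta,\xi)=C(D_X\eta,\xi)+C(\eta,D^C_X\xi).$$ Put $$(\hat D_X\gamma)(Y)\xi=D_X(\gamma(Y)\xi)-\gamma(\nabla_XY)\xi-\gamma(Y)D^C_X\xi,$$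 and let the torsion $\mathcal T(X,Y)=(\hat D_X\gamma)(Y)-(\hat D_Y\gamma)(X)$ be twice the skew-symmetric part of $\hat D\gamma$. Let $\varphi,\psi$ be smooth spinor fields with $D^C\varphi=D^C\psi=0$ on which the symmetric part of $\hat D\gamma$ acts trivially, i.e. $(\hat D_X\gamma)(Y)\xi+(\hat D_Y\gamma)(X)\xi=0$ for $\xi=\varphi,\psi$ and all vector fields $X,Y$. Then $\{\varphi,\psi\}$ is a Killing vector field, i.e. it is smooth and $\mathcal L_{\{\varphi,\psi\}}g=0$ (for complex $S$: its real and imaginary parts are Killing), and for all vector fields $X,Y$ $$g(\nabla_X\{\varphi,\psi\},Y)=C(\varphi,\mathcal T(X,Y)\psi),$$ where $g$ and $\nabla$ are extended complex-linearly to complex vector fields. -/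

import Mathlib

open Bundle VectorField
open scoped Manifold ContDiff Topology

noncomputable section

namespace SpinGeom

/-! ### Pseudo-Riemannian metrics, Levi-Civita connection, Killing fields -/

section Metric

variable {n : ℕ} (M : Type*) [TopologicalSpace M] [ChartedSpace (EuclideanSpace ℝ (Fin n)) M]
  [IsManifold (𝓡 n) ∞ M]

/-- A smooth pseudo-Riemannian metric (of arbitrary signature) on an `n`-dimensional manifold. -/
structure PseudoRiemannianMetric where
  val (x : M) : TangentSpace (𝓡 n) x →L[ℝ] TangentSpace (𝓡 n) x →L[ℝ] ℝ
  symm (x : M) (v w : TangentSpace (𝓡 n) x) : val x v w = val x w v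
  nondegenerate (x : M) (v : TangentSpace (𝓡 n) x) (hv : ∀ w, val x v w = 0) : v = 0
  contMDiff : ContMDiff (𝓡 n)
    ((𝓡 n).prod 𝓘(ℝ, EuclideanSpace ℝ (Fin n) →L[ℝ] EuclideanSpace ℝ (Fin n) →L[ℝ] ℝ)) ∞
    (fun x ↦ TotalSpace.mk'
      (EuclideanSpace ℝ (Fin n) →L[ℝ] EuclideanSpace ℝ (Fin n) →L[ℝ] ℝ) x (val x))

variable {M}

/-- The vector field `X` is differentiable at `x`. -/
abbrev DiffVecAt (X : Π x : M, TangentSpace (𝓡 n) x) (x : M) : Prop :=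
  MDifferentiableAt (𝓡 n) ((𝓡 n).prod 𝓘(ℝ, EuclideanSpace ℝ (Fin n)))
    (fun y ↦ TotalSpace.mk' (EuclideanSpace ℝ (Fin n)) y (X y)) x

/-- The vector field `X` is smooth on the set `s`. -/
abbrev SmoothVecOn (X : Π x : M, TangentSpace (𝓡 n) x) (s : Set M) : Prop :=
  ContMDiffOn (𝓡 n) ((𝓡 n).prod 𝓘(ℝ, EuclideanSpace ℝ (Fin n))) ∞
    (fun y ↦ TotalSpace.mk' (EuclideanSpace ℝ (Fin n)) y (X y)) s

namespace PseudoRiemannianMetric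

variable (g : PseudoRiemannianMetric (n := n) M)

/-- The metric at `x` as an algebraic bilinear form. -/
def bilin (x : M) : LinearMap.BilinForm ℝ (TangentSpace (𝓡 n) x) :=
  ContinuousLinearMap.coeLM ℝ ∘ₗ (g.val x : TangentSpace (𝓡 n) x →ₗ[ℝ] _)

theorem bilin_nondegenerate (x : M) : (g.bilin x).Nondegenerate :=
  ⟨fun v hv ↦ g.nondegenerate x v hv,
    fun w hw ↦ g.nondegenerate x w fun v ↦ (g.symm x w v).trans (hw v)⟩

instance finiteDimensional_tangentSpace (x : M) :
    FiniteDimensional ℝ (TangentSpace (𝓡 n) x) :=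
  inferInstanceAs (FiniteDimensional ℝ (EuclideanSpace ℝ (Fin n)))

/-- The vector `α♯` with `g (α♯, w) = α w` for all `w`. -/
def sharp (x : M) (α : TangentSpace (𝓡 n) x →ₗ[ℝ] ℝ) : TangentSpace (𝓡 n) x :=
  ((g.bilin x).toDual (g.bilin_nondegenerate x)).symm α

/-- `∇` is the Levi-Civita connection of `g`: it is torsion free and `g` is parallel. -/
structure IsLeviCivita
    (nab : CovariantDerivative (𝓡 n) (EuclideanSpace ℝ (Fin n))
      (TangentSpace (𝓡 n) : M → Type _)) : Prop where
  torsionFree {X Y : Π x : M, TangentSpace (𝓡 n) x} {x : M}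
    (hX : DiffVecAt X x) (hY : DiffVecAt Y x) :
    nab Y x (X x) - nab X x (Y x) = mlieBracket (𝓡 n) X Y x
  metric {X Y : Π x : M, TangentSpace (𝓡 n) x} {x : M}
    (hX : DiffVecAt X x) (hY : DiffVecAt Y x) (v : TangentSpace (𝓡 n) x) :
    mvfderiv (𝓡 n) (fun y ↦ g.val y (X y) (Y y)) x v =
      g.val x (nab X x v) (Y x) + g.val x (X x) (nab Y x v)

/-- The Lie derivative of the metric:
`(𝓛_K g)(X, Y) = K (g (X, Y)) - g ([K, X], Y) - g (X, [K, Y])`. -/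
def lieDeriv (K X Y : Π x : M, TangentSpace (𝓡 n) x) (x : M) : ℝ :=
  mvfderiv (𝓡 n) (fun y ↦ g.val y (X y) (Y y)) x (K x)
    - g.val x (mlieBracket (𝓡 n) K X x) (Y x) - g.val x (X x) (mlieBracket (𝓡 n) K Y x)

/-- A smooth vector field `K` with `𝓛_K g = 0`. -/
def IsKilling (K : Π x : M, TangentSpace (𝓡 n) x) : Prop :=
  SmoothVecOn K Set.univ ∧
    ∀ (x : M) (X Y : Π x : M, TangentSpace (𝓡 n) x),
      DiffVecAt X x → DiffVecAt Y x → g.lieDeriv K X Y x = 0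

end PseudoRiemannianMetric

end Metric

/-! ### Clifford modules and charge conjugations -/

section Clifford

variable {n : ℕ}

/-- The quadratic form `v ↦ -∑ a, ε a * (v a)²`, so that in its Clifford algebra
`v w + w v = -2 ⟨v, w⟩` for the inner product `⟨v, w⟩ = ∑ a, ε a * v a * w a`. -/
def cliffordForm (ε : Fin n → ℤˣ) : QuadraticForm ℝ (Fin n → ℝ) :=
  QuadraticMap.weightedSumSquares ℝ (fun a ↦ -((ε a : ℤ) : ℝ))

variable {𝕜 : Type*} [RCLike 𝕜] {F : Type*} [NormedAddCommGroup F] [NormedSpace ℝ F]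
  [NormedSpace 𝕜 F] [IsScalarTower ℝ 𝕜 F] [FiniteDimensional ℝ F] {ε : Fin n → ℤˣ}

/-- A charge conjugation on a real or complex Clifford module: a nondegenerate spin-invariant
bilinear form for which both `(φ, ψ) ↦ C (φ, ψ)` and `(φ, ψ) ↦ C (φ, v ψ)` have a definite
symmetry `Δ₀`, `Δ₁`. Here `spinGroup` consists of the even products `s` of invertible vectors with
`reverse s * s = 1`, which is the group that preserves such forms in every signature. -/
structure ChargeConjugation
    (ρ : CliffordAlgebra (cliffordForm ε) →ₐ[ℝ] Module.End 𝕜 F) where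
  form : LinearMap.BilinForm 𝕜 F
  nondegenerate : form.Nondegenerate
  spin_invariant : ∀ s ∈ spinGroup (cliffordForm ε), ∀ φ ψ : F,
    form (ρ s φ) (ρ s ψ) = form φ ψ
  Δ₀ : ℤˣ
  Δ₁ : ℤˣ
  symm₀ : ∀ φ ψ : F, form φ ψ = ((Δ₀ : ℤ) : 𝕜) * form ψ φ
  symm₁ : ∀ (v : Fin n → ℝ) (φ ψ : F),
    form φ (ρ (CliffordAlgebra.ι (cliffordForm ε) v) ψ) =
      ((Δ₁ : ℤ) : 𝕜) * form ψ (ρ (CliffordAlgebra.ι (cliffordForm ε) v) φ)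

end Clifford

/-! ### Spin structures and spinor bundles -/

section Spin

variable {n : ℕ} {M : Type*} [TopologicalSpace M] [ChartedSpace (EuclideanSpace ℝ (Fin n)) M]
  [IsManifold (𝓡 n) ∞ M]

/-- A spin structure on `(M, g)`, presented by an open cover with a smooth orthonormal frame of
type `ε` on each member, and a smooth cocycle in the spin group that lifts the transition functions
of these frames. -/
structure SpinStructure (g : PseudoRiemannianMetric (n := n) M) (ε : Fin n → ℤˣ)
    (ι : Type*) where
  baseSet : ι → Set M
  isOpen_baseSet : ∀ i, IsOpen (baseSet i)
  indexAt : M → ι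
  mem_baseSet_at : ∀ x, x ∈ baseSet (indexAt x)
  frame : ι → Fin n → Π x : M, TangentSpace (𝓡 n) x
  contMDiffOn_frame : ∀ i a, SmoothVecOn (frame i a) (baseSet i)
  orthonormal : ∀ i, ∀ x ∈ baseSet i, ∀ a b,
    g.val x (frame i a x) (frame i b x) = if a = b then ((ε a : ℤ) : ℝ) else 0
  /-- `trans i j` carries the description with respect to `i` to the one with respect to `j`. -/
  trans : ι → ι → M → CliffordAlgebra (cliffordForm ε)
  trans_mem : ∀ i j, ∀ x ∈ baseSet i ∩ baseSet j, trans i j x ∈ spinGroup (cliffordForm ε)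
  /-- Smoothness of the coordinates of `trans i j` in the finite-dimensional Clifford algebra. -/
  contMDiffOn_trans : ∀ i j (l : CliffordAlgebra (cliffordForm ε) →ₗ[ℝ] ℝ),
    ContMDiffOn (𝓡 n) 𝓘(ℝ, ℝ) ∞ (fun x ↦ l (trans i j x)) (baseSet i ∩ baseSet j)
  trans_self : ∀ i, ∀ x ∈ baseSet i, trans i i x = 1
  trans_comp : ∀ i j k, ∀ x ∈ baseSet i ∩ baseSet j ∩ baseSet k,
    trans j k x * trans i j x = trans i k x
  /-- `trans i j x` acts on vectors by conjugation as the change of frame at `x`. -/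
  trans_lift : ∀ i j, ∀ x ∈ baseSet i ∩ baseSet j, ∀ v w : Fin n → ℝ,
    ∑ a, v a • frame i a x = ∑ a, w a • frame j a x →
    trans i j x * CliffordAlgebra.ι (cliffordForm ε) v =
      CliffordAlgebra.ι (cliffordForm ε) w * trans i j x

variable {g : PseudoRiemannianMetric (n := n) M} {ε : Fin n → ℤˣ} {ι : Type*}
  (P : SpinStructure g ε ι)
  {𝕜 : Type*} [RCLike 𝕜] {F : Type*} [NormedAddCommGroup F] [NormedSpace ℝ F]
  [NormedSpace 𝕜 F] [IsScalarTower ℝ 𝕜 F] [FiniteDimensional ℝ F]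
  (ρ : CliffordAlgebra (cliffordForm ε) →ₐ[ℝ] Module.End 𝕜 F)

/-- The Clifford action, with values in the continuous real endomorphisms. -/
def actionCLM : CliffordAlgebra (cliffordForm ε) →ₗ[ℝ] (F →L[ℝ] F) where
  toFun s := LinearMap.toContinuousLinearMap ((ρ s).restrictScalars ℝ)
  map_add' s t := by ext; simp
  map_smul' c s := by ext; simp

theorem contMDiffOn_actionCLM_trans (i j : ι) :
    ContMDiffOn (𝓡 n) 𝓘(ℝ, F →L[ℝ] F) ∞ (fun x ↦ actionCLM ρ (P.trans i j x))
      (P.baseSet i ∩ P.baseSet j) := by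
  let b := Module.finBasis ℝ (F →L[ℝ] F)
  have h : (fun x ↦ actionCLM ρ (P.trans i j x)) =
      fun x ↦ ∑ k, (b.coord k ∘ₗ actionCLM ρ) (P.trans i j x) • b k := by
    funext x
    exact (b.sum_repr _).symm
  rw [h]
  exact contMDiffOn_finsetSum fun k _ ↦
    (P.contMDiffOn_trans i j (b.coord k ∘ₗ actionCLM ρ)).smul contMDiffOn_const

namespace SpinStructure

/-- The coordinates of a tangent vector with respect to the `i`-th orthonormal frame. -/
def coord (i : ι) (x : M) : TangentSpace (𝓡 n) x →ₗ[ℝ] (Fin n → ℝ) :=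
  LinearMap.pi fun a ↦ ((ε a : ℤ) : ℝ) • (g.val x (P.frame i a x)).toLinearMap

/-- The spinor bundle: the vector bundle with fibre `F` associated with the spin structure by the
action of the spin group on the Clifford module `F`. -/
def spinorBundle : VectorBundleCore ℝ M F ι where
  baseSet := P.baseSet
  isOpen_baseSet := P.isOpen_baseSet
  indexAt := P.indexAt
  mem_baseSet_at := P.mem_baseSet_at
  coordChange i j x := actionCLM ρ (P.trans i j x)
  coordChange_self i x hx v := by simp [actionCLM, P.trans_self i x hx]
  continuousOn_coordChange i j := (contMDiffOn_actionCLM_trans P ρ i j).continuousOn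
  coordChange_comp i j k x hx v := by simp [actionCLM, ← P.trans_comp i j k x hx]

instance : (P.spinorBundle ρ).IsContMDiff (𝓡 n) ∞ :=
  ⟨contMDiffOn_actionCLM_trans P ρ⟩

/-- The spinor space at `x`. As a type it is `F`, identified through the frame `P.indexAt x`. -/
abbrev Spinor (x : M) : Type _ := (P.spinorBundle ρ).Fiber x

instance (x : M) : IsTopologicalAddGroup (P.Spinor ρ x) :=
  inferInstanceAs (IsTopologicalAddGroup F)

instance (x : M) : ContinuousSMul ℝ (P.Spinor ρ x) :=
  inferInstanceAs (ContinuousSMul ℝ F)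

/-- The spinor field `ξ` is differentiable at `x`. -/
abbrev DiffSpinorAt {ρ : CliffordAlgebra (cliffordForm ε) →ₐ[ℝ] Module.End 𝕜 F}
    (ξ : Π x : M, P.Spinor ρ x) (x : M) : Prop :=
  MDifferentiableAt (𝓡 n) ((𝓡 n).prod 𝓘(ℝ, F)) (fun y ↦ TotalSpace.mk' F y (ξ y)) x

/-- The spinor field `ξ` is smooth. -/
abbrev SmoothSpinor {ρ : CliffordAlgebra (cliffordForm ε) →ₐ[ℝ] Module.End 𝕜 F}
    (ξ : Π x : M, P.Spinor ρ x) : Prop :=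
  ContMDiff (𝓡 n) ((𝓡 n).prod 𝓘(ℝ, F)) ∞ (fun y ↦ TotalSpace.mk' F y (ξ y))

/-- Clifford multiplication `γ (v) ψ` of a spinor by a tangent vector at `x`. -/
def clifford (x : M) (v : TangentSpace (𝓡 n) x) (ψ : P.Spinor ρ x) : P.Spinor ρ x :=
  (ρ (CliffordAlgebra.ι (cliffordForm ε) (P.coord (P.indexAt x) x v)) : F →ₗ[𝕜] F) ψ

variable {ρ} (C : ChargeConjugation ρ)

/-- The charge conjugation on the spinor space at `x`. -/
def pairing (x : M) (φ ψ : P.Spinor ρ x) : 𝕜 := C.form (φ : F) (ψ : F)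

/-- The form `C₁ (φ ⊗ ψ)`, that is `v ↦ C (φ, γ (v) ψ)`. -/
def C₁ (φ ψ : Π x : M, P.Spinor ρ x) (x : M) : TangentSpace (𝓡 n) x →ₗ[ℝ] 𝕜 where
  toFun v := P.pairing C x (φ x) (P.clifford ρ x v (ψ x))
  map_add' v w := by
    simp only [pairing, clifford, map_add]
    exact map_add _ _ _
  map_smul' c v := by
    simp only [pairing, clifford, map_smul]
    exact LinearMap.map_smul_of_tower _ _ _

/-- The real part of the `𝕜`-valued vector field `{φ, ψ} = 2 C₁ (φ ⊗ ψ)`, where forms are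
identified with vectors by the metric. For `𝕜 = ℝ` this is the whole field. -/
def bracketRe (φ ψ : Π x : M, P.Spinor ρ x) (x : M) : TangentSpace (𝓡 n) x :=
  g.sharp x (RCLike.reLm ∘ₗ ((2 : ℝ) • P.C₁ C φ ψ x))

/-- The imaginary part of the `𝕜`-valued vector field `{φ, ψ} = 2 C₁ (φ ⊗ ψ)`. -/
def bracketIm (φ ψ : Π x : M, P.Spinor ρ x) (x : M) : TangentSpace (𝓡 n) x :=
  g.sharp x (RCLike.imLm ∘ₗ ((2 : ℝ) • P.C₁ C φ ψ x))

variable (D DC : CovariantDerivative (𝓡 n) F (P.Spinor ρ))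
  (nab : CovariantDerivative (𝓡 n) (EuclideanSpace ℝ (Fin n)) (TangentSpace (𝓡 n) : M → Type _))

/-- `DC` is the connection `D^C` associated with `D`: the charge conjugation is parallel with
respect to `D ⊗ 1 + 1 ⊗ D^C`. As `C` is nondegenerate this determines `D^C`. -/
def IsChargeConjugate : Prop :=
  ∀ (φ ψ : Π x : M, P.Spinor ρ x) (x : M), P.DiffSpinorAt φ x → P.DiffSpinorAt ψ x →
    ∀ v : TangentSpace (𝓡 n) x,
      mvfderiv (𝓡 n) (fun y ↦ P.pairing C y (φ y) (ψ y)) x v =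
        P.pairing C x (D φ x v) (ψ x) + P.pairing C x (φ x) (DC ψ x v)

/-- `(D̂_Z γ)(X) ξ = D_Z (γ (X) ξ) - γ (∇_Z X) ξ - γ (X) D^C_Z ξ`. -/
def hatDGamma (Z X : Π x : M, TangentSpace (𝓡 n) x) (ξ : Π x : M, P.Spinor ρ x) (x : M) :
    P.Spinor ρ x :=
  D (fun y ↦ P.clifford ρ y (X y) (ξ y)) x (Z x) - P.clifford ρ x (nab X x (Z x)) (ξ x)
    - P.clifford ρ x (X x) (DC ξ x (Z x))

/-- The symmetric part of `D̂ γ`, applied to a spinor field. -/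
def symmPart (X Y : Π x : M, TangentSpace (𝓡 n) x) (ξ : Π x : M, P.Spinor ρ x) (x : M) :
    P.Spinor ρ x :=
  (1 / 2 : ℝ) • (P.hatDGamma D DC nab X Y ξ x + P.hatDGamma D DC nab Y X ξ x)

/-- The skew-symmetric part of `D̂ γ`, applied to a spinor field. -/
def skewPart (X Y : Π x : M, TangentSpace (𝓡 n) x) (ξ : Π x : M, P.Spinor ρ x) (x : M) :
    P.Spinor ρ x :=
  (1 / 2 : ℝ) • (P.hatDGamma D DC nab X Y ξ x - P.hatDGamma D DC nab Y X ξ x)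

/-- The torsion `𝒯 (X, Y) ξ` of the spinor connection `D`. -/
def torsion (X Y : Π x : M, TangentSpace (𝓡 n) x) (ξ : Π x : M, P.Spinor ρ x) (x : M) :
    P.Spinor ρ x :=
  (2 : ℝ) • P.skewPart D DC nab X Y ξ x

/-- The symmetric part of `D̂ γ` acts trivially on the spinor field `ξ`. -/
def SymmPartActsTrivially (ξ : Π x : M, P.Spinor ρ x) : Prop :=
  ∀ (x : M) (X Y : Π x : M, TangentSpace (𝓡 n) x), DiffVecAt X x → DiffVecAt Y x →
    P.symmPart D DC nab X Y ξ x = 0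

/-- `ξ` is a smooth spinor field with `D ξ = 0`. -/
def IsParallel (D : CovariantDerivative (𝓡 n) F (P.Spinor ρ)) (ξ : Π x : M, P.Spinor ρ x) :
    Prop :=
  P.SmoothSpinor ξ ∧ ∀ x, D ξ x = 0

end SpinStructure

end Spin

end SpinGeom

end

noncomputable section

namespace SpinGeom

/-! Write `K` for the field dual to `2 l (C (φ, γ(·) ψ))`, where `l` is a real linear form on `𝕜`;
the real and imaginary parts are treated together this way. Metric compatibility gives `g(∇_X K, Y)
= X g(K, Y) - g(K, ∇_X Y)`. Since `D^C φ = 0`, the derivative of `C (φ, γ(Y) ψ)` along `X` is `C (φ,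
D_X (γ(Y) ψ))`. Since `D^C ψ = 0`, the remaining terms assemble to `g(∇_X K, Y) = 2 l (C (φ, (D̂_X
γ)(Y) ψ))`, which is `val_nab_bracketOf`. As the symmetric part of `D̂ γ` kills `ψ`, the right side
is skew in `X, Y`, so `K` is Killing; and twice `(D̂_X γ)(Y) ψ` is the torsion, which gives the
formula. The analytic input is that in a local spin frame the pairing and Clifford multiplication
have constant coefficients (`form_spinorCoord`, `spinorCoord_clifford`), so everything
differentiated is differentiable and `K` is smooth. -/

theorem mvfderiv_clm_apply {n : ℕ} {M : Type*} [TopologicalSpace M]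
    [ChartedSpace (EuclideanSpace ℝ (Fin n)) M]
    {E E' : Type*} [NormedAddCommGroup E] [NormedSpace ℝ E]
    [NormedAddCommGroup E'] [NormedSpace ℝ E'] (L : E →L[ℝ] E') {f : M → E} {x : M}
    (hf : MDifferentiableAt (𝓡 n) 𝓘(ℝ, E) f x) (v : TangentSpace (𝓡 n) x) :
    mvfderiv (𝓡 n) (fun y ↦ L (f y)) x v = L (mvfderiv (𝓡 n) f x v) :=
  congrArg (fun A ↦ A v) (L.hasMFDerivAt.comp x hf.hasMFDerivAt).mfderiv

theorem sign_mul_self (u : ℤˣ) : ((u : ℤ) : ℝ) * ((u : ℤ) : ℝ) = 1 := by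
  rcases Int.units_eq_one_or u with rfl | rfl <;> simp

/-! ### Metric duality and the Killing criterion -/

section Metric

variable {n : ℕ} {M : Type*} [TopologicalSpace M] [ChartedSpace (EuclideanSpace ℝ (Fin n)) M]
  [IsManifold (𝓡 n) ∞ M] (g : PseudoRiemannianMetric (n := n) M)

namespace PseudoRiemannianMetric

theorem val_sharp (x : M) (α : TangentSpace (𝓡 n) x →ₗ[ℝ] ℝ) (w : TangentSpace (𝓡 n) x) :
    g.val x (g.sharp x α) w = α w :=
  LinearMap.BilinForm.apply_toDual_symm_apply (hB := g.bilin_nondegenerate x) α w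

theorem mdifferentiableAt_val {X Y : Π x : M, TangentSpace (𝓡 n) x} {x : M}
    (hX : DiffVecAt X x) (hY : DiffVecAt Y x) :
    MDifferentiableAt (𝓡 n) 𝓘(ℝ, ℝ) (fun y ↦ g.val y (X y) (Y y)) x := by
  have h : MDifferentiableAt (𝓡 n) ((𝓡 n).prod 𝓘(ℝ, ℝ))
      (fun y ↦ TotalSpace.mk' ℝ (E := Bundle.Trivial M ℝ) y (g.val y (X y) (Y y))) x :=
    MDifferentiableAt.clm_bundle_apply₂ (F₁ := EuclideanSpace ℝ (Fin n))
      (F₂ := EuclideanSpace ℝ (Fin n))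
      ((g.contMDiff x).mdifferentiableAt (by simp)) hX hY
  exact ((mdifferentiableAt_totalSpace _ _).1 h).2

variable {g}

/-- If `∇ K` is skew-symmetric, then `K` is a Killing field. -/
theorem IsLeviCivita.isKilling_of_skew
    {nab : CovariantDerivative (𝓡 n) (EuclideanSpace ℝ (Fin n))
      (TangentSpace (𝓡 n) : M → Type _)} (hnab : g.IsLeviCivita nab)
    {K : Π x : M, TangentSpace (𝓡 n) x} (hK : SmoothVecOn K Set.univ)
    (hskew : ∀ (x : M) (X Y : Π x : M, TangentSpace (𝓡 n) x), DiffVecAt X x → DiffVecAt Y x →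
      g.val x (nab K x (X x)) (Y x) + g.val x (nab K x (Y x)) (X x) = 0) :
    g.IsKilling K := by
  refine ⟨hK, fun x X Y hX hY ↦ ?_⟩
  have hKx : DiffVecAt K x := (contMDiffOn_univ.1 hK x).mdifferentiableAt (by simp)
  -- With `[K, X] = ∇_K X - ∇_X K`, the `∇_K` terms cancel against the product rule and leave `g(∇_X
  -- K, Y) + g(X, ∇_Y K)`.
  rw [lieDeriv, hnab.metric hX hY, ← hnab.torsionFree hKx hX, ← hnab.torsionFree hKx hY]
  have h := hskew x X Y hX hY
  simp only [map_sub, sub_apply]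
  rw [g.symm x (X x) (nab K x (Y x))]
  linarith

end PseudoRiemannianMetric

end Metric

/-! ### Local frames and spinors in local coordinates -/

namespace SpinStructure

variable {n : ℕ} {M : Type*} [TopologicalSpace M] [ChartedSpace (EuclideanSpace ℝ (Fin n)) M]
  [IsManifold (𝓡 n) ∞ M]
  {g : PseudoRiemannianMetric (n := n) M} {ε : Fin n → ℤˣ} {ι : Type*}
  (P : SpinStructure g ε ι)

theorem frame_linearIndependent {i : ι} {x : M} (hx : x ∈ P.baseSet i) :
    LinearIndependent ℝ (fun a ↦ P.frame i a x) := by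
  rw [Fintype.linearIndependent_iff]
  intro c hc b
  have h := congrArg (fun v ↦ g.val x v (P.frame i b x)) hc
  simpa [P.orthonormal i x hx] using h

/-- By nondegeneracy it suffices to pair both sides with the frame vectors, which span because they
are `n` independent vectors; there the signs cancel by `ε b * ε b = 1`. -/
theorem sum_coord_smul_frame {i : ι} {x : M} (hx : x ∈ P.baseSet i) (v : TangentSpace (𝓡 n) x) :
    ∑ a, P.coord i x v a • P.frame i a x = v := by
  have hcard : Fintype.card (Fin n) = Module.finrank ℝ (TangentSpace (𝓡 n) x) := by
    exact (Fintype.card_fin n).trans (finrank_euclideanSpace_fin (𝕜 := ℝ) (n := n)).symm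
  have hspan := (P.frame_linearIndependent hx).span_eq_top_of_card_eq_finrank' hcard
  refine sub_eq_zero.1 (g.nondegenerate x _ fun w ↦ ?_)
  have hw : w ∈ Submodule.span ℝ (Set.range fun a ↦ P.frame i a x) := hspan ▸ Submodule.mem_top
  induction hw using Submodule.span_induction with
  | mem w hw =>
    obtain ⟨b, rfl⟩ := hw
    have hb := sign_mul_self (ε b)
    have h1 : g.val x (∑ a, P.coord i x v a • P.frame i a x) (P.frame i b x)
        = P.coord i x v b * (ε b : ℤ) := by
      simp [P.orthonormal i x hx]
    rw [map_sub, sub_apply, h1]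
    simp only [coord, LinearMap.pi_apply, LinearMap.smul_apply, smul_eq_mul,
      ContinuousLinearMap.coe_coe]
    rw [g.symm x (P.frame i b x) v]
    linear_combination (g.val x v (P.frame i b x)) * hb
  | zero => simp
  | add u w _ _ hu hw => rw [map_add, hu, hw, add_zero]
  | smul c w _ hw => rw [map_smul, hw, smul_zero]

variable
  {𝕜 : Type*} [RCLike 𝕜] {F : Type*} [NormedAddCommGroup F] [NormedSpace ℝ F]
  [NormedSpace 𝕜 F] [IsScalarTower ℝ 𝕜 F] [FiniteDimensional ℝ F]
  (ρ : CliffordAlgebra (cliffordForm ε) →ₐ[ℝ] Module.End 𝕜 F)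

/-- The spinor `ξ` at `x`, read in the trivialization given by the `i`-th frame. -/
def spinorCoord (i : ι) (x : M) (ξ : P.Spinor ρ x) : F :=
  actionCLM ρ (P.trans (P.indexAt x) i x) ξ

/-- The two coordinate vectors describe the same tangent vector in two frames, so `trans_lift`
intertwines their Clifford actions. Hence Clifford multiplication looks the same in every
trivialization. -/
theorem spinorCoord_clifford {i : ι} {x : M} (hx : x ∈ P.baseSet i) (v : TangentSpace (𝓡 n) x)
    (ξ : P.Spinor ρ x) :
    P.spinorCoord ρ i x (P.clifford ρ x v ξ) =
      ρ (CliffordAlgebra.ι (cliffordForm ε) (P.coord i x v)) (P.spinorCoord ρ i x ξ) := by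
  have h := P.trans_lift (P.indexAt x) i x ⟨P.mem_baseSet_at x, hx⟩
    (P.coord (P.indexAt x) x v) (P.coord i x v)
    ((P.sum_coord_smul_frame (P.mem_baseSet_at x) v).trans (P.sum_coord_smul_frame hx v).symm)
  have h' := congrArg ρ h
  rw [map_mul, map_mul] at h'
  exact congrArg (fun f : Module.End 𝕜 F ↦ f ξ) h'

variable {ρ}

/-- Transition functions lie in the spin group, which preserves `C.form`; the pairing is therefore a
constant form in each trivialization. -/
theorem form_spinorCoord (C : ChargeConjugation ρ) {i : ι} {x : M} (hx : x ∈ P.baseSet i)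
    (φ ψ : P.Spinor ρ x) :
    C.form (P.spinorCoord ρ i x φ) (P.spinorCoord ρ i x ψ) = P.pairing C x φ ψ :=
  C.spin_invariant _ (P.trans_mem (P.indexAt x) i x ⟨P.mem_baseSet_at x, hx⟩) φ ψ

theorem diffSpinorAt_iff {ξ : Π x : M, P.Spinor ρ x} {x : M} :
    P.DiffSpinorAt ξ x ↔
      MDifferentiableAt (𝓡 n) 𝓘(ℝ, F) (fun y ↦ P.spinorCoord ρ (P.indexAt x) y (ξ y)) x :=
  mdifferentiableAt_section _ _

theorem contMDiffAt_spinorCoord {ξ : Π x : M, P.Spinor ρ x} (hξ : P.SmoothSpinor ξ) (x : M) :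
    ContMDiffAt (𝓡 n) 𝓘(ℝ, F) ∞ (fun y ↦ P.spinorCoord ρ (P.indexAt x) y (ξ y)) x :=
  (contMDiffAt_section x).1 (hξ x)

theorem SmoothSpinor.diffSpinorAt {ξ : Π x : M, P.Spinor ρ x} (hξ : P.SmoothSpinor ξ) (x : M) :
    P.DiffSpinorAt ξ x :=
  (hξ x).mdifferentiableAt (by simp)

theorem baseSet_indexAt_mem_nhds (x : M) : P.baseSet (P.indexAt x) ∈ 𝓝 x :=
  (P.isOpen_baseSet _).mem_nhds (P.mem_baseSet_at x)

theorem contMDiffAt_frame (x : M) (a : Fin n) :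
    ContMDiffAt (𝓡 n) ((𝓡 n).prod 𝓘(ℝ, EuclideanSpace ℝ (Fin n))) ∞
      (fun y ↦ TotalSpace.mk' (EuclideanSpace ℝ (Fin n)) y (P.frame (P.indexAt x) a y)) x :=
  (P.contMDiffOn_frame _ a).contMDiffAt (P.baseSet_indexAt_mem_nhds x)

theorem mdifferentiableAt_coord {X : Π x : M, TangentSpace (𝓡 n) x} {x : M}
    (hX : DiffVecAt X x) (a : Fin n) :
    MDifferentiableAt (𝓡 n) 𝓘(ℝ, ℝ) (fun y ↦ P.coord (P.indexAt x) y (X y) a) x :=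
  (g.mdifferentiableAt_val ((P.contMDiffAt_frame x a).mdifferentiableAt (by simp))
    hX).const_smul ((ε a : ℤ) : ℝ)

/-- Clifford multiplication of a differentiable spinor field by a differentiable vector field. -/
theorem DiffSpinorAt.clifford {ξ : Π x : M, P.Spinor ρ x} {X : Π x : M, TangentSpace (𝓡 n) x}
    {x : M} (hξ : P.DiffSpinorAt ξ x) (hX : DiffVecAt X x) :
    P.DiffSpinorAt (fun y ↦ P.clifford ρ y (X y) (ξ y)) x := by
  rw [diffSpinorAt_iff] at hξ ⊢
  let L : (Fin n → ℝ) →L[ℝ] F →L[ℝ] F :=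
    LinearMap.toContinuousLinearMap (actionCLM ρ ∘ₗ CliffordAlgebra.ι (cliffordForm ε))
  have hc : MDifferentiableAt (𝓡 n) 𝓘(ℝ, Fin n → ℝ)
      (fun y ↦ P.coord (P.indexAt x) y (X y)) x :=
    (MDifferentiableAt.sum (t := Finset.univ) fun a _ ↦ (P.mdifferentiableAt_coord hX a).smul
      (mdifferentiableAt_const (c := (Pi.single a 1 : Fin n → ℝ)))).congr_of_eventuallyEq
        (.of_forall fun y ↦ by
          simpa [Finset.sum_apply] using (pi_eq_sum_univ' (P.coord (P.indexAt x) y (X y))))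
  -- In the trivialization, the product is the constant bilinear map `L` applied to the coordinates
  -- of `X` and `ξ`.
  have h := (L.mdifferentiableAt.comp x hc).clm_apply hξ
  refine h.congr_of_eventuallyEq ?_
  filter_upwards [P.baseSet_indexAt_mem_nhds x] with y hy
  exact P.spinorCoord_clifford ρ hy _ _

end SpinStructure

/-- The charge conjugation as a continuous real bilinear map. -/
def ChargeConjugation.formCLM {n : ℕ} {ε : Fin n → ℤˣ}
    {𝕜 : Type*} [RCLike 𝕜] {F : Type*} [NormedAddCommGroup F] [NormedSpace ℝ F]
    [NormedSpace 𝕜 F] [IsScalarTower ℝ 𝕜 F] [FiniteDimensional ℝ F]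
    {ρ : CliffordAlgebra (cliffordForm ε) →ₐ[ℝ] Module.End 𝕜 F} (C : ChargeConjugation ρ) :
    F →L[ℝ] F →L[ℝ] 𝕜 :=
  LinearMap.toContinuousLinearMap
    { toFun φ := LinearMap.toContinuousLinearMap ((C.form φ).restrictScalars ℝ)
      map_add' φ ψ := by ext; simp
      map_smul' c φ := by
        ext ψ
        exact congrArg (fun f ↦ f ψ) (LinearMap.map_smul_of_tower C.form c φ) }

/-! ### Regularity of the pairing and of the bracket -/

namespace SpinStructure

variable {n : ℕ} {M : Type*} [TopologicalSpace M] [ChartedSpace (EuclideanSpace ℝ (Fin n)) M]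
  [IsManifold (𝓡 n) ∞ M]
  {g : PseudoRiemannianMetric (n := n) M} {ε : Fin n → ℤˣ} {ι : Type*}
  (P : SpinStructure g ε ι)
  {𝕜 : Type*} [RCLike 𝕜] {F : Type*} [NormedAddCommGroup F] [NormedSpace ℝ F]
  [NormedSpace 𝕜 F] [IsScalarTower ℝ 𝕜 F] [FiniteDimensional ℝ F]
  {ρ : CliffordAlgebra (cliffordForm ε) →ₐ[ℝ] Module.End 𝕜 F} (C : ChargeConjugation ρ)

theorem mdifferentiableAt_pairing {φ ψ : Π x : M, P.Spinor ρ x} {x : M}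
    (hφ : P.DiffSpinorAt φ x) (hψ : P.DiffSpinorAt ψ x) :
    MDifferentiableAt (𝓡 n) 𝓘(ℝ, 𝕜) (fun y ↦ P.pairing C y (φ y) (ψ y)) x := by
  rw [diffSpinorAt_iff] at hφ hψ
  refine ((C.formCLM.mdifferentiableAt.comp x hφ).clm_apply hψ).congr_of_eventuallyEq ?_
  filter_upwards [P.baseSet_indexAt_mem_nhds x] with y hy
  exact (P.form_spinorCoord C hy _ _).symm

theorem coord_frame {i : ι} {x : M} (hx : x ∈ P.baseSet i) (a : Fin n) :
    P.coord i x (P.frame i a x) = Pi.single a 1 := by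
  have hb := sign_mul_self (ε a)
  ext b
  rcases eq_or_ne b a with rfl | h
  · simp [coord, P.orthonormal i x hx, hb]
  · simp [coord, P.orthonormal i x hx, h]

/-- On its own frame, a frame vector has constant coordinates, so it acts by a fixed endomorphism of
`F`; only the coordinates of `φ` and `ψ` vary. -/
theorem contMDiffAt_C₁_frame {φ ψ : Π x : M, P.Spinor ρ x} (hφ : P.SmoothSpinor φ)
    (hψ : P.SmoothSpinor ψ) (x : M) (a : Fin n) :
    ContMDiffAt (𝓡 n) 𝓘(ℝ, 𝕜) ∞ (fun y ↦ P.C₁ C φ ψ y (P.frame (P.indexAt x) a y)) x := by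
  have h := (C.formCLM.contMDiff.contMDiffAt.comp x (P.contMDiffAt_spinorCoord hφ x)).clm_apply
    ((actionCLM ρ (CliffordAlgebra.ι (cliffordForm ε) (Pi.single a 1))).contMDiff.contMDiffAt.comp
      x (P.contMDiffAt_spinorCoord hψ x))
  refine h.congr_of_eventuallyEq ?_
  filter_upwards [P.baseSet_indexAt_mem_nhds x] with y hy
  refine (P.form_spinorCoord C hy _ _).symm.trans ?_
  rw [P.spinorCoord_clifford ρ hy, P.coord_frame hy]
  rfl

/-- The vector field metrically dual to the image of `2 C₁ (φ ⊗ ψ)` under a real linear form. -/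
def bracketOf (l : 𝕜 →ₗ[ℝ] ℝ) (φ ψ : Π x : M, P.Spinor ρ x) (x : M) : TangentSpace (𝓡 n) x :=
  g.sharp x (l ∘ₗ ((2 : ℝ) • P.C₁ C φ ψ x))

theorem val_bracketOf (l : 𝕜 →ₗ[ℝ] ℝ) (φ ψ : Π x : M, P.Spinor ρ x) (x : M)
    (v : TangentSpace (𝓡 n) x) :
    g.val x (P.bracketOf C l φ ψ x) v =
      2 * l (P.pairing C x (φ x) (P.clifford ρ x v (ψ x))) := by
  rw [bracketOf, g.val_sharp, LinearMap.comp_apply, LinearMap.smul_apply, map_smul, smul_eq_mul]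
  rfl

/-- Expand `K = ∑ a, ε a * g(K, e_a) e_a` in the local frame: the coefficients are `2 * ε a` times
`l` of the smooth functions `C₁ (φ ⊗ ψ)(e_a)`. -/
theorem smoothVecOn_bracketOf (l : 𝕜 →ₗ[ℝ] ℝ) {φ ψ : Π x : M, P.Spinor ρ x}
    (hφ : P.SmoothSpinor φ) (hψ : P.SmoothSpinor ψ) :
    SmoothVecOn (P.bracketOf C l φ ψ) Set.univ := by
  refine contMDiffOn_univ.2 fun x ↦ ?_
  let l' : 𝕜 →L[ℝ] ℝ := LinearMap.toContinuousLinearMap l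
  have h := ContMDiffAt.sum_section (s := Finset.univ) fun a _ ↦
    ((((ε a : ℤ) : ℝ) • (2 : ℝ) • l').contMDiff.contMDiffAt.comp x
      (P.contMDiffAt_C₁_frame C hφ hψ x a)).smul_section (P.contMDiffAt_frame x a)
  refine h.congr_of_eventuallyEq ?_
  filter_upwards [P.baseSet_indexAt_mem_nhds x] with y hy
  congr 1
  conv_lhs => rw [← P.sum_coord_smul_frame hy (P.bracketOf C l φ ψ y)]
  refine Finset.sum_congr rfl fun a _ ↦ ?_
  change _ = (((ε a : ℤ) : ℝ) * (2 * l _)) • P.frame (P.indexAt x) a y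
  congr 1
  change ((ε a : ℤ) : ℝ) * _ = _
  rw [ContinuousLinearMap.coe_coe, g.symm, P.val_bracketOf]
  rfl

/-! ### Covariant derivative of the bracket and torsion -/

variable {C} {D DC : CovariantDerivative (𝓡 n) F (P.Spinor ρ)}

theorem pairing_symm (x : M) (φ ψ : P.Spinor ρ x) :
    P.pairing C x φ ψ = ((C.Δ₀ : ℤ) : ℝ) • P.pairing C x ψ φ := by
  rw [RCLike.real_smul_eq_coe_mul, RCLike.ofReal_intCast]
  exact C.symm₀ φ ψ

/-- The product rule for `C (φ, ξ)`, when `φ` is parallel for the charge conjugate connection. -/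
theorem IsChargeConjugate.mvfderiv_pairing_of_parallel (hDC : P.IsChargeConjugate C D DC)
    {φ ξ : Π x : M, P.Spinor ρ x} {x : M} (hφ : P.DiffSpinorAt φ x) (hξ : P.DiffSpinorAt ξ x)
    (hp : DC φ x = 0) (v : TangentSpace (𝓡 n) x) :
    mvfderiv (𝓡 n) (fun y ↦ P.pairing C y (φ y) (ξ y)) x v =
      P.pairing C x (φ x) (D ξ x v) := by
  -- The defining rule of `DC` differentiates the second slot with `DC`, while `φ` sits in the
  -- first; the symmetry `Δ₀` swaps the slots, and is undone after the `DC φ` term has vanished.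
  have hf : (fun y ↦ P.pairing C y (φ y) (ξ y)) = fun y ↦
      (((C.Δ₀ : ℤ) : ℝ) • ContinuousLinearMap.id ℝ 𝕜) (P.pairing C y (ξ y) (φ y)) :=
    funext fun y ↦ P.pairing_symm (C := C) y (φ y) (ξ y)
  have h0 : P.pairing C x (ξ x) (DC φ x v) = 0 := by
    rw [hp]
    exact map_zero (C.form (ξ x : F))
  rw [hf, mvfderiv_clm_apply _ (P.mdifferentiableAt_pairing C hξ hφ), hDC ξ φ x hξ hφ v, h0,
    add_zero, P.pairing_symm x (φ x)]
  rfl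

theorem pairing_sub (x : M) (φ ξ η : P.Spinor ρ x) :
    P.pairing C x φ (ξ - η) = P.pairing C x φ ξ - P.pairing C x φ η :=
  map_sub (C.form (φ : F)) (ξ : F) (η : F)

theorem pairing_smul (x : M) (c : ℝ) (φ ξ : P.Spinor ρ x) :
    P.pairing C x φ (c • ξ) = c • P.pairing C x φ ξ :=
  LinearMap.map_smul_of_tower (C.form (φ : F)) c (ξ : F)

variable {nab : CovariantDerivative (𝓡 n) (EuclideanSpace ℝ (Fin n))
  (TangentSpace (𝓡 n) : M → Type _)}

/-- The heart of the argument: metric compatibility supplies the term with `∇_X Y`, the product rule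
the term with `D_X (γ(Y) ψ)`, and `D^C ψ = 0` makes the third term of `D̂ γ` vanish. -/
theorem val_nab_bracketOf (hnab : g.IsLeviCivita nab)
    (hDC : P.IsChargeConjugate C D DC) (l : 𝕜 →ₗ[ℝ] ℝ)
    {φ ψ : Π x : M, P.Spinor ρ x} (hφ : P.IsParallel DC φ) (hψ : P.IsParallel DC ψ)
    {x : M} (X : Π x : M, TangentSpace (𝓡 n) x) {Y : Π x : M, TangentSpace (𝓡 n) x}
    (hY : DiffVecAt Y x) :
    g.val x (nab (P.bracketOf C l φ ψ) x (X x)) (Y x) =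
      2 * l (P.pairing C x (φ x) (P.hatDGamma D DC nab X Y ψ x)) := by
  let l' : 𝕜 →L[ℝ] ℝ := (2 : ℝ) • LinearMap.toContinuousLinearMap l
  have hK : DiffVecAt (P.bracketOf C l φ ψ) x :=
    (contMDiffOn_univ.1 (P.smoothVecOn_bracketOf C l hφ.1 hψ.1) x).mdifferentiableAt (by simp)
  have hφx := SmoothSpinor.diffSpinorAt P hφ.1 x
  have hγ := DiffSpinorAt.clifford P (SmoothSpinor.diffSpinorAt P hψ.1 x) hY
  have hmet := hnab.metric hK hY (X x)
  have hf : (fun y ↦ g.val y (P.bracketOf C l φ ψ y) (Y y)) = fun y ↦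
      l' (P.pairing C y (φ y) (P.clifford ρ y (Y y) (ψ y))) :=
    funext fun y ↦ P.val_bracketOf C l φ ψ y (Y y)
  rw [hf, mvfderiv_clm_apply l' (P.mdifferentiableAt_pairing C hφx hγ),
    IsChargeConjugate.mvfderiv_pairing_of_parallel P hDC hφx hγ (hφ.2 x),
    P.val_bracketOf] at hmet
  have h0 : P.clifford ρ x (Y x) (DC ψ x (X x)) = 0 := by
    rw [hψ.2 x]
    exact map_zero (ρ (CliffordAlgebra.ι (cliffordForm ε) (P.coord (P.indexAt x) x (Y x))))
  rw [hatDGamma, h0, sub_zero, pairing_sub, map_sub, mul_sub]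
  exact eq_sub_of_add_eq hmet.symm

theorem hatDGamma_swap {ξ : Π x : M, P.Spinor ρ x} (h : P.SymmPartActsTrivially D DC nab ξ)
    {x : M} {X Y : Π x : M, TangentSpace (𝓡 n) x} (hX : DiffVecAt X x) (hY : DiffVecAt Y x) :
    P.hatDGamma D DC nab Y X ξ x = -P.hatDGamma D DC nab X Y ξ x := by
  have := h x X Y hX hY
  rw [symmPart, smul_eq_zero_iff_right (by norm_num)] at this
  exact (neg_eq_of_add_eq_zero_right this).symm

theorem torsion_eq {ξ : Π x : M, P.Spinor ρ x} (h : P.SymmPartActsTrivially D DC nab ξ)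
    {x : M} {X Y : Π x : M, TangentSpace (𝓡 n) x} (hX : DiffVecAt X x) (hY : DiffVecAt Y x) :
    P.torsion D DC nab X Y ξ x = (2 : ℝ) • P.hatDGamma D DC nab X Y ξ x := by
  rw [torsion, skewPart, P.hatDGamma_swap h hX hY, smul_smul, sub_neg_eq_add, ← two_smul ℝ]
  norm_num

theorem val_nab_bracketOf_eq_torsion (hnab : g.IsLeviCivita nab)
    (hDC : P.IsChargeConjugate C D DC) (l : 𝕜 →ₗ[ℝ] ℝ)
    {φ ψ : Π x : M, P.Spinor ρ x} (hφ : P.IsParallel DC φ) (hψ : P.IsParallel DC ψ)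
    (hψs : P.SymmPartActsTrivially D DC nab ψ)
    {x : M} {X Y : Π x : M, TangentSpace (𝓡 n) x} (hX : DiffVecAt X x) (hY : DiffVecAt Y x) :
    g.val x (nab (P.bracketOf C l φ ψ) x (X x)) (Y x) =
      l (P.pairing C x (φ x) (P.torsion D DC nab X Y ψ x)) := by
  rw [P.val_nab_bracketOf hnab hDC l hφ hψ X hY, P.torsion_eq hψs hX hY, pairing_smul, map_smul,
    smul_eq_mul]

/-- Exchanging `X` and `Y` flips the sign of `(D̂_X γ)(Y) ψ`, so `∇ K` is skew. -/
theorem isKilling_bracketOf (hnab : g.IsLeviCivita nab)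
    (hDC : P.IsChargeConjugate C D DC) (l : 𝕜 →ₗ[ℝ] ℝ)
    {φ ψ : Π x : M, P.Spinor ρ x} (hφ : P.IsParallel DC φ) (hψ : P.IsParallel DC ψ)
    (hψs : P.SymmPartActsTrivially D DC nab ψ) :
    g.IsKilling (P.bracketOf C l φ ψ) := by
  refine hnab.isKilling_of_skew (P.smoothVecOn_bracketOf C l hφ.1 hψ.1) fun x X Y hX hY ↦ ?_
  rw [P.val_nab_bracketOf hnab hDC l hφ hψ X hY, P.val_nab_bracketOf hnab hDC l hφ hψ Y hX,
    P.hatDGamma_swap hψs hX hY, ← zero_sub, pairing_sub,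
    show P.pairing C x (φ x) 0 = 0 from map_zero (C.form (φ x : F)), zero_sub, map_neg]
  ring

end SpinStructure

end SpinGeom

end

theorem theorem4p1 {n : ℕ} {M : Type*} [TopologicalSpace M] [T2Space M]
    [ChartedSpace (EuclideanSpace ℝ (Fin n)) M] [IsManifold (𝓡 n) ∞ M]
    {g : SpinGeom.PseudoRiemannianMetric (n := n) M} {ε : Fin n → ℤˣ} {ι : Type*}
    (P : SpinGeom.SpinStructure g ε ι)
    {𝕜 : Type*} [RCLike 𝕜] {F : Type*} [NormedAddCommGroup F] [NormedSpace ℝ F]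
    [NormedSpace 𝕜 F] [IsScalarTower ℝ 𝕜 F] [FiniteDimensional ℝ F]
    {ρ : CliffordAlgebra (SpinGeom.cliffordForm ε) →ₐ[ℝ] Module.End 𝕜 F}
    (C : SpinGeom.ChargeConjugation ρ)
    (nab : CovariantDerivative (𝓡 n) (EuclideanSpace ℝ (Fin n))
      (TangentSpace (𝓡 n) : M → Type _))
    (hnab : g.IsLeviCivita nab)
    (D DC : CovariantDerivative (𝓡 n) F (P.Spinor ρ))
    (hDC : P.IsChargeConjugate C D DC)
    (φ ψ : Π x : M, P.Spinor ρ x)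
    (hφ : P.IsParallel DC φ) (hψ : P.IsParallel DC ψ)
    (hφs : P.SymmPartActsTrivially D DC nab φ) (hψs : P.SymmPartActsTrivially D DC nab ψ) :
    (g.IsKilling (P.bracketRe C φ ψ) ∧ g.IsKilling (P.bracketIm C φ ψ)) ∧
    ∀ (x : M) (X Y : Π x : M, TangentSpace (𝓡 n) x),
      SpinGeom.DiffVecAt X x → SpinGeom.DiffVecAt Y x →
        (g.val x (nab (P.bracketRe C φ ψ) x (X x)) (Y x) : 𝕜)
          + (g.val x (nab (P.bracketIm C φ ψ) x (X x)) (Y x) : 𝕜) * RCLike.I =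
        P.pairing C x (φ x) (P.torsion D DC nab X Y ψ x) := by
  -- `bracketRe` and `bracketIm` are by definition `bracketOf` for `l = re` and `l = im`; the
  -- `𝕜`-valued formula is recovered from `z = re z + im z * I`.
  refine ⟨⟨P.isKilling_bracketOf hnab hDC RCLike.reLm hφ hψ hψs,
    P.isKilling_bracketOf hnab hDC RCLike.imLm hφ hψ hψs⟩, fun x X Y hX hY ↦ ?_⟩
  have hre := P.val_nab_bracketOf_eq_torsion hnab hDC RCLike.reLm hφ hψ hψs hX hY
  have him := P.val_nab_bracketOf_eq_torsion hnab hDC RCLike.imLm hφ hψ hψs hX hY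
  refine .trans ?_ (RCLike.re_add_im (P.pairing C x (φ x) (P.torsion D DC nab X Y ψ x)))
  exact congrArg₂ (fun a b : ℝ ↦ (a : 𝕜) + (b : 𝕜) * RCLike.I) hre him
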